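/- Let $t \in \mathbb{R}$. Let $M(t)$ be the $12$-dimensional real commutative (non-associative) algebra with basis $a_1, a_{-1}, a_2, a_{-2}, a_3, a_{-3}, v_1, v_2, v_3, w_1, w_2, w_3$ (here $v_k = v_{(i,j)}$ and $w_k = a_k \cdot v_{(i,j)}$ for $\{i,j,k\} = \{1,2,3\}$) whose product is the bilinear one given as follows, for all $\{i,j,k\} = \{1,2,3\}$ and all signs $\varepsilon, \delta \in \{1,-1\}$: $$a_{\varepsilon i} \cdot a_{\varepsilon i} = a_{\varepsilon i}, \qquad a_i \cdot a_{-i} = 0, \qquad a_{\varepsilon i} \cdot a_{\delta j} = \tfrac{1}{64}\left(3a_{\varepsilon i} + 3a_{\delta j} + a_{-\varepsilon i} + a_{-\delta j} - 3v_k\right),$$ $$a_i \cdot v_i = w_i, \qquad a_{-i} \cdot v_i = w_i - t(a_i - a_{-i}), \qquad a_{\varepsilon i} \cdot v_k = \tfrac{1}{16}\left(5a_{\varepsilon i} - 2a_j - 2a_{-j} - a_{-\varepsilon i} + 3v_k\right),$$ $$a_i \cdot w_i = \tfrac{3t}{4}a_i + \tfrac14 w_i, \qquad a_{-i} \cdot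 w_i = -\tfrac{t}{4}a_i + \tfrac14 w_i,$$ $$a_j \cdot w_i = \tfrac{t}{8}a_j - \tfrac{3t}{64}(a_i - a_{-i}) + \tfrac{t}{16}(a_k - a_{-k}) + \tfrac{1}{16}(2w_i + w_j - 2w_k),$$ $$a_{-j} \cdot w_i = \tfrac{t}{16}(3a_{-j} - a_j) - \tfrac{3t}{64}(a_i - a_{-i}) + \tfrac{t}{16}(a_k - a_{-k}) + \tfrac{1}{16}(2w_i + w_j - 2w_k),$$ $$v_i \cdot v_i = v_i, \qquad v_j \cdot v_k = -\tfrac{8t}{3}a_i + \tfrac{2t}{3}(a_j - a_{-j} + a_k - a_{-k}) + \tfrac14(v_j + v_k - v_i) + \tfrac43(2w_i - w_j - w_k),$$ $$v_i \cdot w_i = \tfrac{(2t-1)t}{4}(a_i - a_{-i}) + \tfrac{t}{4}v_i + \tfrac12 w_i,$$ $$v_k \cdot w_i = -\tfrac{5t}{48}a_i - \tfrac{11t}{48}a_{-i} - \tfrac{11t}{24}a_j - \tfrac{5t}{24}a_{-j} + \tfrac{t}{8}v_k + \tfrac14(w_i + w_j),$$ $$w_i \cdot w_i = \tfrac{(10t+1)t}{16}a_i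 - \tfrac{(2t-1)t}{16}a_{-i} + \tfrac{t}{16}v_i + \tfrac{t}{4}w_i,$$ $$w_i \cdot w_j = \tfrac{t^2}{32}(a_i - a_{-i} + a_j - a_{-j}) + \tfrac{(2t-1)t}{32}a_k - \tfrac{(2t+1)t}{32}a_{-k} + \tfrac{t}{64}(2v_k + v_i + v_j) + \tfrac{t}{8}(w_i + w_j - w_k).$$ Let $\langle\,,\,\rangle$ be the Frobenius form on $M(t)$, that is, the symmetric bilinear form given, for all $i \neq j$ in $\{1,2,3\}$ and all signs $\varepsilon, \delta$, by $$\langle a_{\varepsilon i}, a_{\varepsilon i}\rangle = 1, \quad \langle a_i, a_{-i}\rangle = 0, \quad \langle a_{\varepsilon i}, a_{\delta j}\rangle = \tfrac{1}{32}, \quad \langle a_{\varepsilon i}, v_i\rangle = t, \quad \langle a_{\varepsilon i}, v_j\rangle = \tfrac38,$$ $$\langle a_i, w_i\rangle = t, \quad \langle a_{-i}, w_i\rangle = 0, \quad \langle a_{\varepsilon j}, w_i\rangle = \tfrac{3t}{16}, \quad \langle v_i, v_i\rangle = 2, \quad \langle v_i, v_j\rangle = \tfrac12 - \tfrac{8t}{3},$$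 $$\langle v_i, w_i\rangle = t, \quad \langle v_j, w_i\rangle = -\tfrac{t}{4}, \quad \langle w_i, w_i\rangle = \tfrac{(3t+1)t}{4}, \quad \langle w_i, w_j\rangle = \tfrac{(2t+1)t}{16}.$$ Then $M(t)$ satisfies Norton's inequality $$\langle u \cdot u, v \cdot v \rangle \geq \langle u \cdot v, u \cdot v \rangle \quad \text{for all } u, v \in M(t)$$ if and only if $t \in [0, \tfrac16]$. -/

import Mathlib

namespace FourA

/-- Labels of the twelve basis vectors of the algebra `M(t)`. The indices `1, 2, 3` of the six axes
are represented by `Fin 3` (in this cyclic order `0, 1, 2`), and a sign by a `Bool` (`true` is `+`).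
* `a i true` is the axis `a_i` and `a i false` is the axis `a_{-i}`;
* `v k` is the vector `v_{(i,j)}`, where `{i, j, k} = {1, 2, 3}`;
* `w k` is the vector `a_k · v_{(i,j)}`, where `{i, j, k} = {1, 2, 3}`. -/
inductive Idx : Type
  | a (i : Fin 3) (s : Bool)
  | v (k : Fin 3)
  | w (k : Fin 3)
  deriving DecidableEq, Fintype

/-- The underlying real vector space of the 12-dimensional algebra `M(t)`: coordinate vectors with
respect to the basis. The six axes generate the algebra, and `t` is the value `⟨a_1, v_{(2,3)}⟩` of
the Frobenius form. -/
def M (_t : ℝ) : Type := Idx → ℝ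

noncomputable instance (t : ℝ) : AddCommGroup (M t) := inferInstanceAs (AddCommGroup (Idx → ℝ))

noncomputable instance (t : ℝ) : Module ℝ (M t) := inferInstanceAs (Module ℝ (Idx → ℝ))

/-- The basis vector with a given label. -/
noncomputable def e (t : ℝ) (p : Idx) : M t := (Pi.single p 1 : Idx → ℝ)

/-- The axis `a_i` (for `s = true`) or `a_{-i}` (for `s = false`). -/
noncomputable def ax (t : ℝ) (i : Fin 3) (s : Bool) : M t := e t (Idx.a i s)

/-- The vector `v_{(i,j)}`, labelled by the third index `k`. -/
noncomputable def vv (t : ℝ) (k : Fin 3) : M t := e t (Idx.v k)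

/-- The vector `a_k · v_{(i,j)}`, where `{i, j, k} = {1, 2, 3}`. -/
noncomputable def ww (t : ℝ) (k : Fin 3) : M t := e t (Idx.w k)

/-- For `i ≠ j`, the index different from `i` and `j`: the three indices sum to zero modulo `3`. -/
def third (i j : Fin 3) : Fin 3 := -(i + j)

/-- The products `a_{±i} · a_{±j}`: the axes are idempotents, `⟨⟨a_i, a_{-i}⟩⟩` is a dihedral
algebra of type `2B`, and `⟨⟨a_{±i}, a_{±j}⟩⟩` is a dihedral algebra of type `4A` for `i ≠ j`. -/
noncomputable def mulAA (t : ℝ) (i : Fin 3) (s : Bool) (j : Fin 3) (r : Bool) : M t :=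
  if i = j then (if s = r then ax t i s else 0)
  else (1 / 64 : ℝ) • ((3 : ℝ) • ax t i s + (3 : ℝ) • ax t j r + ax t i (!s) + ax t j (!r)
    - (3 : ℝ) • vv t (third i j))

/-- The products of `a_{±i}` with the vector `v` labelled by `k`. If `i = k`, then
`a_i · v = w` is a basis vector and `a_{-i} · v = w - t (a_i - a_{-i})`; if `i ≠ k`, then the product
lies in the dihedral algebra of type `4A` generated by `a_i` and `a_j`, where `j` is the third
index. -/
noncomputable def mulAV (t : ℝ) (i : Fin 3) (s : Bool) (k : Fin 3) : M t :=
  if i = k then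
    (if s = true then ww t k else ww t k - t • (ax t k true - ax t k false))
  else (1 / 16 : ℝ) • ((5 : ℝ) • ax t i s
    - (2 : ℝ) • (ax t (third i k) true + ax t (third i k) false) - ax t i (!s)
    + (3 : ℝ) • vv t k)

/-- The products of `a_{±j}` with the vector `w` labelled by `i`. -/
noncomputable def mulAW (t : ℝ) (j : Fin 3) (s : Bool) (i : Fin 3) : M t :=
  if j = i then
    (if s = true then (3 * t / 4) • ax t i true + (1 / 4 : ℝ) • ww t i
      else (-t / 4) • ax t i true + (1 / 4 : ℝ) • ww t i)
  else
    (if s = true then (2 * t / 16) • ax t j true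
      else (t / 16) • ((3 : ℝ) • ax t j false - ax t j true))
    - (3 * t / 64) • (ax t i true - ax t i false)
    + (t / 16) • (ax t (third i j) true - ax t (third i j) false)
    + (1 / 16 : ℝ) • ((2 : ℝ) • ww t i + ww t j - (2 : ℝ) • ww t (third i j))

/-- The products `v_{(i,k)} · v_{(i,j)}`, labelled by `j` and `k`. -/
noncomputable def mulVV (t : ℝ) (j k : Fin 3) : M t :=
  if j = k then vv t j
  else
    (-(8 * t / 3)) • ax t (third j k) true
    + (2 * t / 3) • (ax t j true - ax t j false + ax t k true - ax t k false)
    + (1 / 4 : ℝ) • (vv t j + vv t k - vv t (third j k))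
    + (4 / 3 : ℝ) • ((2 : ℝ) • ww t (third j k) - ww t j - ww t k)

/-- The products of the vector `v` labelled by `k` with the vector `w` labelled by `i`. -/
noncomputable def mulVW (t : ℝ) (k i : Fin 3) : M t :=
  if k = i then
    ((2 * t - 1) * t / 4) • (ax t i true - ax t i false) + (t / 4) • vv t i
    + (1 / 2 : ℝ) • ww t i
  else
    (-(5 * t / 48)) • ax t i true - (11 * t / 48) • ax t i false
    - (11 * t / 24) • ax t (third i k) true - (5 * t / 24) • ax t (third i k) false
    + (t / 8) • vv t k + (1 / 4 : ℝ) • (ww t i + ww t (third i k))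

/-- The products of the vectors `w` labelled by `i` and `j`. -/
noncomputable def mulWW (t : ℝ) (i j : Fin 3) : M t :=
  if i = j then
    ((10 * t + 1) * t / 16) • ax t i true - ((2 * t - 1) * t / 16) • ax t i false
    + (t / 16) • vv t i + (t / 4) • ww t i
  else
    (t ^ 2 / 32) • (ax t i true - ax t i false + ax t j true - ax t j false)
    + ((2 * t - 1) * t / 32) • ax t (third i j) true
    - ((2 * t + 1) * t / 32) • ax t (third i j) false
    + (t / 64) • ((2 : ℝ) • vv t (third i j) + vv t i + vv t j)
    + (t / 8) • (ww t i + ww t j - ww t (third i j))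

/-- The algebra product of two basis vectors. -/
noncomputable def mulBasis (t : ℝ) : Idx → Idx → M t
  | .a i s, .a j r => mulAA t i s j r
  | .a i s, .v k => mulAV t i s k
  | .v k, .a i s => mulAV t i s k
  | .a j s, .w i => mulAW t j s i
  | .w i, .a j s => mulAW t j s i
  | .v j, .v k => mulVV t j k
  | .v k, .w i => mulVW t k i
  | .w i, .v k => mulVW t k i
  | .w i, .w j => mulWW t i j

theorem mulAA_comm (t : ℝ) (i : Fin 3) (s : Bool) (j : Fin 3) (r : Bool) :
    mulAA t i s j r = mulAA t j r i s := by
  unfold mulAA third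
  rw [add_comm i j]
  by_cases h : i = j
  · subst h
    by_cases h' : s = r
    · subst h'; rfl
    · simp [h', Ne.symm h']
  · simp only [h, Ne.symm h, if_false]
    module

theorem mulVV_comm (t : ℝ) (j k : Fin 3) : mulVV t j k = mulVV t k j := by
  unfold mulVV third
  rw [add_comm j k]
  by_cases h : j = k
  · subst h; rfl
  · simp only [h, Ne.symm h, if_false]
    module

theorem mulWW_comm (t : ℝ) (i j : Fin 3) : mulWW t i j = mulWW t j i := by
  unfold mulWW third
  rw [add_comm i j]
  by_cases h : i = j
  · subst h; rfl
  · simp only [h, Ne.symm h, if_false]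
    module

theorem mulBasis_comm (t : ℝ) (p q : Idx) : mulBasis t p q = mulBasis t q p := by
  cases p <;> cases q <;> simp only [mulBasis]
  · exact mulAA_comm _ _ _ _ _
  · exact mulVV_comm _ _ _
  · exact mulWW_comm _ _ _

/-- The algebra product on `M(t)`: the bilinear extension of the product of basis vectors. -/
noncomputable def mulM (t : ℝ) (x y : M t) : M t :=
  ∑ p : Idx, ∑ q : Idx, (x p * y q) • mulBasis t p q

theorem M_add_apply (t : ℝ) (x y : M t) (p : Idx) : (x + y) p = x p + y p := rfl

theorem M_smul_apply (t c : ℝ) (x : M t) (p : Idx) : (c • x) p = c * x p := rfl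

theorem M_zero_apply (t : ℝ) (p : Idx) : (0 : M t) p = 0 := rfl

theorem mulM_comm (t : ℝ) (x y : M t) : mulM t x y = mulM t y x := by
  unfold mulM
  rw [Finset.sum_comm]
  refine Finset.sum_congr rfl fun p _ => Finset.sum_congr rfl fun q _ => ?_
  rw [mulBasis_comm, mul_comm]

theorem mulM_add (t : ℝ) (x y z : M t) : mulM t x (y + z) = mulM t x y + mulM t x z := by
  simp only [mulM, M_add_apply, mul_add, add_smul, Finset.sum_add_distrib]

theorem mulM_zero (t : ℝ) (x : M t) : mulM t x 0 = 0 := by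
  simp [mulM, M_zero_apply]

/-- `M(t)` is a commutative, not necessarily associative, ring. -/
noncomputable instance (t : ℝ) : NonUnitalNonAssocCommRing (M t) where
  __ := (inferInstance : AddCommGroup (M t))
  mul := mulM t
  left_distrib := mulM_add t
  right_distrib x y z := by
    change mulM t (x + y) z = mulM t x z + mulM t y z
    rw [mulM_comm, mulM_add, mulM_comm t z x, mulM_comm t z y]
  zero_mul x := by
    change mulM t 0 x = 0
    rw [mulM_comm, mulM_zero]
  mul_zero := mulM_zero t
  mul_comm := mulM_comm t

theorem M_mul_def (t : ℝ) (x y : M t) :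
    x * y = ∑ p : Idx, ∑ q : Idx, (x p * y q) • mulBasis t p q := rfl

theorem e_mul_e (t : ℝ) (p q : Idx) : e t p * e t q = mulBasis t p q := by
  rw [M_mul_def]
  simp [e, Pi.single_apply]

instance (t : ℝ) : IsScalarTower ℝ (M t) (M t) where
  smul_assoc c x y := by
    change (c • x) * y = c • (x * y)
    simp only [M_mul_def, M_smul_apply, Finset.smul_sum, smul_smul, mul_assoc]

instance (t : ℝ) : SMulCommClass ℝ (M t) (M t) where
  smul_comm c x y := by
    change c • (x * y) = x * (c • y)
    rw [mul_comm x y, mul_comm x (c • y)]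
    exact (smul_assoc c y x).symm

/-- The value of the Frobenius form on two basis vectors. -/
noncomputable def gram (t : ℝ) : Idx → Idx → ℝ
  | .a i s, .a j r => if i = j then (if s = r then 1 else 0) else 1 / 32
  | .a i _, .v k => if i = k then t else 3 / 8
  | .v k, .a i _ => if i = k then t else 3 / 8
  | .a j s, .w i => if j = i then (if s = true then t else 0) else 3 * t / 16
  | .w i, .a j s => if j = i then (if s = true then t else 0) else 3 * t / 16
  | .v j, .v k => if j = k then 2 else -(8 * t / 3) + 1 / 2
  | .v k, .w i => if k = i then t else -(t / 4)
  | .w i, .v k => if k = i then t else -(t / 4)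
  | .w i, .w j => if i = j then (3 * t + 1) * t / 4 else (2 * t + 1) * t / 16

/-- The Frobenius form on `M(t)`: the bilinear extension of its values on basis vectors. -/
noncomputable def form (t : ℝ) : LinearMap.BilinForm ℝ (M t) :=
  LinearMap.mk₂ ℝ (fun x y => ∑ p : Idx, ∑ q : Idx, x p * y q * gram t p q)
    (fun x y z => by simp only [M_add_apply, add_mul, Finset.sum_add_distrib])
    (fun c x y => by simp only [M_smul_apply, mul_assoc, Finset.mul_sum, smul_eq_mul])
    (fun x y z => by simp only [M_add_apply, mul_add, add_mul, Finset.sum_add_distrib])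
    (fun c x y => by
      simp only [M_smul_apply, Finset.mul_sum, smul_eq_mul]
      exact Finset.sum_congr rfl fun p _ => Finset.sum_congr rfl fun q _ => by ring)

theorem e_apply (t : ℝ) (p q : Idx) : e t p q = if q = p then 1 else 0 := by
  simp [e, Pi.single_apply]

theorem form_e_e (t : ℝ) (p q : Idx) : form t (e t p) (e t q) = gram t p q := by
  simp [form, e_apply]

/-- Norton's inequality for a real commutative algebra with a bilinear form:
`⟨u · u, v · v⟩ ≥ ⟨u · v, u · v⟩` for all `u` and `v`. -/
def NortonInequality {V : Type*} [NonUnitalNonAssocCommRing V] [Module ℝ V]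
    (B : LinearMap.BilinForm ℝ V) : Prop :=
  ∀ u v : V, B (u * u) (v * v) ≥ B (u * v) (u * v)

end FourA

namespace FourA

/-! Exchanging `a_i` with `a_{-i}` and `w_i` with `w_i - t (a_i - a_{-i})` is an automorphism for
each `i`. The resulting grading by `(ℤ/2)^3` has a 9-dimensional even part `E`, spanned by the `a_i
+ a_{-i}`, `v_i` and `w_i - (t / 2) (a_i - a_{-i})`, and three lines spanned by `d_i = a_i -
a_{-i}`, each with its own character. Hence `d_i d_j = 0` for `i ≠ j`, `d_i d_i = a_i + a_{-i}`, and
`E` acts on `d_i` by the scalar `charE`.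

The difference of the two sides of Norton's inequality thus splits (`norton_eq`) into a part on `E`,
a part coupling each `d_i` to `E`, and a sum of squares. The part on `E` depends only on the
bivector `x ∧ y`; splitting it under `S_3` writes it through `signForm` and `standardForm`
(`nortonE_eq`). The part at `d_i` splits under the exchange of the other two indices into
`axisOddForm` and `axisEvenForm` (`axis_eq`). Completing squares in these four small forms leaves
multiples of `9 - 58 t + 24 t ^ 2 = (1 - 6 t) (9 - 4 t)`, so they are nonnegative on `[0, 1/6]`.

Conversely, pairing `d_1` with suitable elements of `E` isolates the two axis forms, whose
nonnegativity forces `t ∈ [0, 1/6]`. -/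

/-! ### Product and Frobenius form in coordinates adapted to the grading. -/

theorem sum_idx {α : Type*} [AddCommMonoid α] (f : Idx → α) :
    ∑ p : Idx, f p = (∑ i, ∑ s, f (.a i s)) + (∑ k, f (.v k)) + ∑ k, f (.w k) := by
  let φ : (Fin 3 × Bool) ⊕ Fin 3 ⊕ Fin 3 ≃ Idx :=
    { toFun := Sum.elim (fun p => .a p.1 p.2) (Sum.elim .v .w)
      invFun := fun
        | .a i s => .inl (i, s)
        | .v k => .inr (.inl k)
        | .w k => .inr (.inr k)
      left_inv := by rintro (⟨i, s⟩ | k | k) <;> rfl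
      right_inv := by rintro (⟨i, s⟩ | k | k) <;> rfl }
  rw [← φ.sum_comp f, Fintype.sum_sum_type, Fintype.sum_sum_type, Fintype.sum_prod_type,
    add_assoc]
  rfl

theorem M_sub_apply (t : ℝ) (x y : M t) (p : Idx) : (x - y) p = x p - y p := rfl

theorem M_neg_apply (t : ℝ) (x : M t) (p : Idx) : (-x) p = -x p := rfl

/-- The coordinate of `x` at `a_i - a_{-i}`, in the basis formed by `a_i - a_{-i}`, `a_i + a_{-i}`,
`v_i` and `w_i - (t / 2) (a_i - a_{-i})`. -/
noncomputable def dCoord {t : ℝ} (x : M t) (i : Fin 3) : ℝ :=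
  (x (.a i true) - x (.a i false)) / 2 + t / 2 * x (.w i)

/-- The coordinate of `x` at `a_i + a_{-i}`. -/
noncomputable def sCoord {t : ℝ} (x : M t) (i : Fin 3) : ℝ :=
  (x (.a i true) + x (.a i false)) / 2

/-- The elements of `M(t)` fixed by all the exchanges of `a_i` with `a_{-i}`: the coordinates
`x 0 i`, `x 1 i` and `x 2 i` belong to `a_i + a_{-i}`, `v_i` and
`w_i - (t / 2) (a_i - a_{-i})`. -/
abbrev Even : Type := Fin 3 → Fin 3 → ℝ

/-- The even part of an element of `M(t)`. -/
noncomputable def evenPart {t : ℝ} (x : M t) : Even :=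
  ![sCoord x, fun i => x (.v i), fun i => x (.w i)]

/-- The character with which the even part of `M(t)` acts on `a_i - a_{-i}`. -/
noncomputable def charE (t : ℝ) (x : Even) (i : Fin 3) : ℝ :=
  x 0 i + (x 0 (i + 1) + x 0 (i + 2)) / 16 + t * x 1 i + 3 / 8 * (x 1 (i + 1) + x 1 (i + 2))
    + t / 2 * x 2 i + 3 * t / 16 * (x 2 (i + 1) + x 2 (i + 2))

/-- The polarization of the quadratic form `x A i * x B j`. -/
def polar (x y : Even) (A B i j : Fin 3) : ℝ := x A i * y B j + y A i * x B j

/-- The product of the even subalgebra of `M(t)`. -/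
noncomputable def mulE (t : ℝ) (x y : Even) : Even := ![
  fun i => x 0 i * y 0 i + 1 / 8 * (polar x y 0 0 i (i + 1) + polar x y 0 0 i (i + 2))
    + 1 / 4 * (polar x y 0 1 i (i + 1) + polar x y 0 1 i (i + 2)
      - polar x y 0 1 (i + 1) (i + 2) - polar x y 0 1 (i + 2) (i + 1))
    + t / 4 * polar x y 0 2 i i
    + t / 8 * (polar x y 0 2 i (i + 1) + polar x y 0 2 i (i + 2))
    - 4 * t / 3 * polar x y 1 1 (i + 1) (i + 2)
    - t / 3 * (polar x y 1 2 (i + 1) (i + 2) + polar x y 1 2 (i + 2) (i + 1))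
    - t / 6 * (polar x y 1 2 (i + 1) i + polar x y 1 2 (i + 2) i)
    + t / 16 * (x 2 i * y 2 i) - t / 32 * polar x y 2 2 (i + 1) (i + 2),
  fun i => -(3 / 16) * polar x y 0 0 (i + 1) (i + 2)
    + 3 / 8 * (polar x y 0 1 (i + 1) i + polar x y 0 1 (i + 2) i)
    + x 1 i * y 1 i
    + 1 / 4 * (polar x y 1 1 i (i + 1) + polar x y 1 1 i (i + 2)
      - polar x y 1 1 (i + 1) (i + 2))
    + t / 4 * polar x y 1 2 i i
    + t / 8 * (polar x y 1 2 i (i + 1) + polar x y 1 2 i (i + 2))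
    + t / 16 * (x 2 i * y 2 i)
    + t / 64 * (polar x y 2 2 i (i + 1) + polar x y 2 2 i (i + 2))
    + t / 32 * polar x y 2 2 (i + 1) (i + 2),
  fun i => 2 * polar x y 0 1 i i + 1 / 2 * polar x y 0 2 i i
    + 1 / 8 * (polar x y 0 2 i (i + 1) + polar x y 0 2 i (i + 2))
    + 1 / 4 * (polar x y 0 2 (i + 1) i + polar x y 0 2 (i + 2) i
      - polar x y 0 2 (i + 1) (i + 2) - polar x y 0 2 (i + 2) (i + 1))
    + 4 / 3 * (2 * polar x y 1 1 (i + 1) (i + 2) - polar x y 1 1 i (i + 1)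
      - polar x y 1 1 i (i + 2))
    + 1 / 2 * polar x y 1 2 i i
    + 1 / 4 * (polar x y 1 2 (i + 1) i + polar x y 1 2 (i + 2) i
      + polar x y 1 2 (i + 1) (i + 2) + polar x y 1 2 (i + 2) (i + 1))
    + t / 4 * (x 2 i * y 2 i)
    + t / 8 * (polar x y 2 2 i (i + 1) + polar x y 2 2 i (i + 2)
      - polar x y 2 2 (i + 1) (i + 2))]

/-- The Frobenius form on the even subalgebra of `M(t)`. -/
noncomputable def formE (t : ℝ) (x y : Even) : ℝ :=
  ∑ i, (2 * x 0 i * charE t y i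
    + x 1 i * (2 * t * y 0 i + 3 / 4 * (y 0 (i + 1) + y 0 (i + 2)) + 2 * y 1 i
      + (1 / 2 - 8 * t / 3) * (y 1 (i + 1) + y 1 (i + 2))
      + t * y 2 i - t / 4 * (y 2 (i + 1) + y 2 (i + 2)))
    + x 2 i * (t * y 0 i + 3 * t / 8 * (y 0 (i + 1) + y 0 (i + 2))
      + t * y 1 i - t / 4 * (y 1 (i + 1) + y 1 (i + 2)) + (t + t ^ 2) / 4 * y 2 i
      + (t + 2 * t ^ 2) / 16 * (y 2 (i + 1) + y 2 (i + 2))))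

theorem Fin3.index_arith : (0 : Fin 3) + 1 = 1 ∧ (0 : Fin 3) + 2 = 2 ∧ (1 : Fin 3) + 1 = 2 ∧
    (1 : Fin 3) + 2 = 0 ∧ (2 : Fin 3) + 1 = 0 ∧ (2 : Fin 3) + 2 = 1 ∧ -(2 : Fin 3) = 1 ∧
    -(1 : Fin 3) = 2 := by decide

-- Only even times odd contributes to `d_i`: a product `d_j d_k` with `j ≠ k` would have a character
-- that does not occur in the algebra.
set_option maxHeartbeats 4000000 in
theorem dCoord_mul (t : ℝ) (x y : M t) (i : Fin 3) :
    dCoord (x * y) i =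
      dCoord x i * charE t (evenPart y) i + dCoord y i * charE t (evenPart x) i := by
  simp only [dCoord, sCoord, charE, evenPart, Matrix.cons_val, M_mul_def, sum_idx,
    Fin.sum_univ_three, Fintype.sum_bool]
  fin_cases i <;>
  simp [mulBasis, mulAA, mulAV, mulAW, mulVV, mulVW, mulWW, third, Fin3.index_arith, M_add_apply,
    M_sub_apply, M_neg_apply, M_smul_apply, ax, vv, ww, e_apply] <;> ring

set_option maxHeartbeats 4000000 in
theorem evenPart_mul_s (t : ℝ) (x y : M t) (i : Fin 3) :
    (evenPart (x * y)) 0 i = (mulE t (evenPart x) (evenPart y)) 0 i + dCoord x i * dCoord y i := by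
  simp only [dCoord, sCoord, mulE, polar, evenPart, Matrix.cons_val, M_mul_def, sum_idx,
    Fin.sum_univ_three, Fintype.sum_bool]
  fin_cases i <;>
  simp [mulBasis, mulAA, mulAV, mulAW, mulVV, mulVW, mulWW, third, Fin3.index_arith, M_add_apply,
    M_sub_apply, M_neg_apply, M_smul_apply, ax, vv, ww, e_apply] <;> ring

set_option maxHeartbeats 4000000 in
theorem evenPart_mul_v (t : ℝ) (x y : M t) (i : Fin 3) :
    (evenPart (x * y)) 1 i = (mulE t (evenPart x) (evenPart y)) 1 i := by
  simp only [sCoord, mulE, polar, evenPart, Matrix.cons_val, M_mul_def, sum_idx,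
    Fin.sum_univ_three, Fintype.sum_bool]
  fin_cases i <;>
  simp [mulBasis, mulAA, mulAV, mulAW, mulVV, mulVW, mulWW, third, Fin3.index_arith, M_add_apply,
    M_sub_apply, M_neg_apply, M_smul_apply, ax, vv, ww, e_apply] <;> ring

set_option maxHeartbeats 4000000 in
theorem evenPart_mul_u (t : ℝ) (x y : M t) (i : Fin 3) :
    (evenPart (x * y)) 2 i = (mulE t (evenPart x) (evenPart y)) 2 i := by
  simp only [sCoord, mulE, polar, evenPart, Matrix.cons_val, M_mul_def, sum_idx,
    Fin.sum_univ_three, Fintype.sum_bool]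
  fin_cases i <;>
  simp [mulBasis, mulAA, mulAV, mulAW, mulVV, mulVW, mulWW, third, Fin3.index_arith, M_add_apply,
    M_sub_apply, M_neg_apply, M_smul_apply, ax, vv, ww, e_apply] <;> ring

theorem form_apply (t : ℝ) (x y : M t) :
    form t x y = ∑ p : Idx, ∑ q : Idx, x p * y q * gram t p q := rfl

set_option maxHeartbeats 4000000 in
theorem form_eq (t : ℝ) (x y : M t) :
    form t x y = formE t (evenPart x) (evenPart y) + 2 * ∑ i, dCoord x i * dCoord y i := by
  simp only [form_apply, dCoord, sCoord, formE, charE, evenPart, Matrix.cons_val, sum_idx,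
    Fin.sum_univ_three, Fintype.sum_bool]
  simp [gram, Fin3.index_arith]
  ring

/-! ### The four small quadratic forms and their nonnegativity on `[0, 1/6]`. -/

/-- The quadratic form giving the part of the Norton form of the even subalgebra on which `S_3` acts
by the sign character. -/
noncomputable def signForm (t a b : ℝ) : ℝ :=
  (3 + 32 * t) / 256 * a ^ 2 + t * (4 + t) / 32 * (a * b) + t * (27 + 38 * t) / 1536 * b ^ 2

/-- The quadratic form giving the part of the Norton form of the even subalgebra on which `S_3` acts
by its two-dimensional representation. -/
noncomputable def standardForm (t a b c : ℝ) : ℝ :=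
  (3 - 8 * t) / 256 * a ^ 2 + t * (9 - 14 * t) / 1536 * b ^ 2 + 3 * t * (1 - t) / 4 * c ^ 2
    + t * (1 - t) / 32 * (a * b) - 5 * t / 16 * (a * c) - t * (3 + 2 * t) / 32 * (b * c)

/-- The quadratic form giving the part of the Norton form between `a_i - a_{-i}` and the even
subalgebra which is odd under the exchange of the other two indices. -/
noncomputable def axisOddForm (t a b : ℝ) : ℝ :=
  (3 + 12 * t) / 128 * a ^ 2 + 5 * t / 32 * (a * b) + t * (3 + 2 * t) / 128 * b ^ 2

/-- The quadratic form giving the part of the Norton form between `a_i - a_{-i}` and the even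
subalgebra which is even under the exchange of the other two indices. -/
noncomputable def axisEvenForm (t a b : ℝ) : ℝ :=
  (9 - 24 * t) / 256 * a ^ 2 + 5 * t / 8 * (a * b) + t * (1 - t) * b ^ 2

/-- The discriminants of the quadratic forms above are multiples of this polynomial. -/
theorem disc_nonneg {t : ℝ} (h1 : t ≤ 1 / 6) : 0 ≤ 9 - 58 * t + 24 * t ^ 2 := by
  -- The polynomial is `(1 - 6 t) (9 - 4 t)`.
  nlinarith

theorem signForm_nonneg {t : ℝ} (h0 : 0 ≤ t) (h1 : t ≤ 1 / 6) (a b : ℝ) :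
    0 ≤ signForm t a b := by
  have hP := disc_nonneg h1
  have hc : 0 < (3 + 32 * t) / 256 := by positivity
  unfold signForm
  refine nonneg_of_mul_nonneg_right ?_ hc
  have h9 : 0 ≤ 9 - 4 * t := by linarith
  have key : (3 + 32 * t) / 256 * ((3 + 32 * t) / 256 * a ^ 2 + t * (4 + t) / 32 * (a * b)
      + t * (27 + 38 * t) / 1536 * b ^ 2) =
      ((3 + 32 * t) / 256 * a + t * (4 + t) / 64 * b) ^ 2
      + t * (9 - 4 * t) * (9 - 58 * t + 24 * t ^ 2) / 393216 * b ^ 2 := by ring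
  rw [key]
  positivity

/-- The square is completed in `c`. The multiplier is the coefficient of `c ^ 2` without its factor
`t`, so it stays positive at `t = 0`; the remainder in `a` and `b` is again diagonalized. -/
theorem standardForm_nonneg {t : ℝ} (h0 : 0 ≤ t) (h1 : t ≤ 1 / 6) (a b c : ℝ) :
    0 ≤ standardForm t a b c := by
  have hP := disc_nonneg h1
  have h1t : 0 < 1 - t := by linarith
  have hc : 0 < 3 / 4 * (1 - t) := by positivity
  unfold standardForm
  refine nonneg_of_mul_nonneg_right ?_ hc
  have key : 3 / 4 * (1 - t) * ((3 - 8 * t) / 256 * a ^ 2 + t * (9 - 14 * t) / 1536 * b ^ 2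
      + 3 * t * (1 - t) / 4 * c ^ 2
      + t * (1 - t) / 32 * (a * b) - 5 * t / 16 * (a * c) - t * (3 + 2 * t) / 32 * (b * c)) =
      t * (3 / 4 * (1 - t) * c - 5 / 32 * a - (3 + 2 * t) / 64 * b) ^ 2
      + (9 - 58 * t + 24 * t ^ 2) / 1024 * (a + t / 2 * b) ^ 2
      + (9 - 58 * t + 24 * t ^ 2) * t * (1 - t) / 4096 * b ^ 2 := by ring
  rw [key]
  positivity

theorem axisOddForm_nonneg {t : ℝ} (h0 : 0 ≤ t) (h1 : t ≤ 1 / 6) (a b : ℝ) :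
    0 ≤ axisOddForm t a b := by
  have hP := disc_nonneg h1
  have hc : 0 < (3 + 12 * t) := by positivity
  unfold axisOddForm
  refine nonneg_of_mul_nonneg_right ?_ hc
  have key : (3 + 12 * t) * ((3 + 12 * t) / 128 * a ^ 2 + 5 * t / 32 * (a * b)
      + t * (3 + 2 * t) / 128 * b ^ 2) =
      ((3 + 12 * t) * a + 10 * t * b) ^ 2 / 128 + t * (9 - 58 * t + 24 * t ^ 2) / 128 * b ^ 2 := by
    ring
  rw [key]
  positivity

theorem axisEvenForm_nonneg {t : ℝ} (h0 : 0 ≤ t) (h1 : t ≤ 1 / 6) (a b : ℝ) :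
    0 ≤ axisEvenForm t a b := by
  have hP := disc_nonneg h1
  have hc : 0 < 1 - t := by linarith
  unfold axisEvenForm
  refine nonneg_of_mul_nonneg_right ?_ hc
  have key : (1 - t) * ((9 - 24 * t) / 256 * a ^ 2 + 5 * t / 8 * (a * b) + t * (1 - t) * b ^ 2) =
      t * ((1 - t) * b + 5 / 16 * a) ^ 2 + (9 - 58 * t + 24 * t ^ 2) / 256 * a ^ 2 := by
    ring
  rw [key]
  positivity

/-! ### The Norton form of the even subalgebra in terms of bivectors. -/

/-- The Plücker coordinates of a pair of vectors. -/
def plucker (x y : Even) (A B i j : Fin 3) : ℝ := x A i * y B j - y A i * x B j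

/-- The first of the two linear forms on bivectors transforming by the sign character of `S_3`
on which the Norton form of the even subalgebra depends. -/
noncomputable def signOne (t : ℝ) (x y : Even) : ℝ :=
  ∑ i, (plucker x y 0 0 i (i + 1)
    + 2 * (plucker x y 0 1 i (i + 1) - plucker x y 0 1 (i + 1) i)
    - 4 * plucker x y 1 1 i (i + 1)
    + 2 * t / 3 * (plucker x y 1 2 i (i + 1) - plucker x y 1 2 (i + 1) i)
    + t / 4 * plucker x y 2 2 i (i + 1))

/-- The second linear form on bivectors transforming by the sign character of `S_3`. -/
noncomputable def signTwo (x y : Even) : ℝ :=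
  ∑ i, (plucker x y 0 2 i (i + 1) - plucker x y 0 2 (i + 1) i
    + 32 / 3 * plucker x y 1 1 i (i + 1))

/-- The first of the three families of linear forms on bivectors transforming by the
two-dimensional representation of `S_3` on which the Norton form of the even subalgebra depends. -/
noncomputable def stdOne (t : ℝ) (x y : Even) (i : Fin 3) : ℝ :=
  plucker x y 0 0 i (i + 1) - plucker x y 0 0 i (i + 2)
    - 2 * plucker x y 0 0 (i + 1) (i + 2)
    + 2 * (plucker x y 0 1 i (i + 1) - plucker x y 0 1 i (i + 2)
      + 2 * plucker x y 0 1 (i + 1) i + plucker x y 0 1 (i + 1) (i + 2)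
      - 2 * plucker x y 0 1 (i + 2) i - plucker x y 0 1 (i + 2) (i + 1))
    - 2 * t / 3 * (2 * plucker x y 1 2 i (i + 1) - 2 * plucker x y 1 2 i (i + 2)
      + plucker x y 1 2 (i + 1) i - plucker x y 1 2 (i + 1) (i + 2)
      - plucker x y 1 2 (i + 2) i + plucker x y 1 2 (i + 2) (i + 1))
    - t / 4 * (plucker x y 2 2 i (i + 1) - plucker x y 2 2 i (i + 2)
      - 2 * plucker x y 2 2 (i + 1) (i + 2))

/-- The second family of linear forms on bivectors transforming by the two-dimensional
representation of `S_3`. -/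
noncomputable def stdTwo (x y : Even) (i : Fin 3) : ℝ :=
  plucker x y 0 2 i (i + 1) - plucker x y 0 2 i (i + 2)
    + 1 / 2 * (plucker x y 0 2 (i + 1) i - plucker x y 0 2 (i + 1) (i + 2)
      - plucker x y 0 2 (i + 2) i + plucker x y 0 2 (i + 2) (i + 1))
    - 16 / 3 * (plucker x y 1 1 i (i + 1) - plucker x y 1 1 i (i + 2)
      - 2 * plucker x y 1 1 (i + 1) (i + 2))
    + 3 * (plucker x y 1 2 (i + 1) i + plucker x y 1 2 (i + 1) (i + 2)
      - plucker x y 1 2 (i + 2) i - plucker x y 1 2 (i + 2) (i + 1))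

/-- The third family of linear forms on bivectors transforming by the two-dimensional
representation of `S_3`. -/
noncomputable def stdThree (x y : Even) (i : Fin 3) : ℝ :=
  plucker x y 0 1 (i + 1) (i + 1) - plucker x y 0 1 (i + 2) (i + 2)
    + 1 / 16 * (plucker x y 0 2 (i + 1) i + plucker x y 0 2 (i + 1) (i + 2)
      - plucker x y 0 2 (i + 2) i - plucker x y 0 2 (i + 2) (i + 1))
    + 1 / 4 * (plucker x y 0 2 (i + 1) (i + 1) - plucker x y 0 2 (i + 2) (i + 2))
    - 2 / 3 * (plucker x y 1 1 i (i + 1) - plucker x y 1 1 i (i + 2)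
      - 2 * plucker x y 1 1 (i + 1) (i + 2))
    + 1 / 8 * (plucker x y 1 2 (i + 1) i + plucker x y 1 2 (i + 1) (i + 2)
      - plucker x y 1 2 (i + 2) i - plucker x y 1 2 (i + 2) (i + 1))
    - 1 / 4 * (plucker x y 1 2 (i + 1) (i + 1) - plucker x y 1 2 (i + 2) (i + 2))

/-- Rotation of the indices `1, 2, 3`. -/
def rot (x : Even) : Even := fun A i => x A (i + 1)

theorem mulE_add (t : ℝ) (x y z : Even) : mulE t x (y + z) = mulE t x y + mulE t x z := by
  ext A i
  fin_cases A <;> simp [mulE, polar] <;> ring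

theorem mulE_smul (t c : ℝ) (x y : Even) : mulE t x (c • y) = c • mulE t x y := by
  ext A i
  fin_cases A <;> simp [mulE, polar] <;> ring

theorem mulE_comm (t : ℝ) (x y : Even) : mulE t x y = mulE t y x := by
  ext A i
  fin_cases A <;> simp [mulE, polar] <;> ring

theorem mulE_rot (t : ℝ) (x y : Even) : mulE t (rot x) (rot y) = rot (mulE t x y) := by
  ext A i
  fin_cases A <;> fin_cases i <;>
    simp only [mulE, polar, rot, Fin.zero_eta, Fin.mk_one, Fin.reduceFinMk, Fin3.index_arith,
      Matrix.cons_val]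

theorem formE_comm (t : ℝ) (x y : Even) : formE t x y = formE t y x := by
  simp only [formE, charE, Fin.sum_univ_three, Fin3.index_arith]
  ring

theorem formE_add (t : ℝ) (x y z : Even) : formE t x (y + z) = formE t x y + formE t x z := by
  simp only [formE, charE, Fin.sum_univ_three, Pi.add_apply]
  ring

theorem formE_smul (t c : ℝ) (x y : Even) : formE t x (c • y) = c * formE t x y := by
  simp only [formE, charE, Fin.sum_univ_three, Pi.smul_apply, smul_eq_mul]
  ring

theorem mulE_add_left (t : ℝ) (x y z : Even) : mulE t (x + y) z = mulE t x z + mulE t y z := by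
  simp only [mulE_comm t _ z, mulE_add]

theorem mulE_smul_left (t c : ℝ) (x y : Even) : mulE t (c • x) y = c • mulE t x y := by
  simp only [mulE_comm t _ y, mulE_smul]

theorem formE_add_left (t : ℝ) (x y z : Even) :
    formE t (x + y) z = formE t x z + formE t y z := by
  simp only [formE_comm t _ z, formE_add]

theorem formE_smul_left (t c : ℝ) (x y : Even) : formE t (c • x) y = c * formE t x y := by
  simp only [formE_comm t _ y, formE_smul]

theorem formE_rot (t : ℝ) (x y : Even) : formE t (rot x) (rot y) = formE t x y := by
  simp only [formE, charE, rot, Fin.sum_univ_three, Fin3.index_arith]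
  ring

theorem signOne_add (t : ℝ) (x y z : Even) :
    signOne t x (y + z) = signOne t x y + signOne t x z := by
  simp only [signOne, plucker, Fin.sum_univ_three, Pi.add_apply]
  ring

theorem signOne_smul (t : ℝ) (c : ℝ) (x y : Even) :
    signOne t x (c • y) = c * signOne t x y := by
  simp only [signOne, plucker, Fin.sum_univ_three, Pi.smul_apply, smul_eq_mul]
  ring

theorem signTwo_add (x y z : Even) :
    signTwo x (y + z) = signTwo x y + signTwo x z := by
  simp only [signTwo, plucker, Fin.sum_univ_three, Pi.add_apply]
  ring

theorem signTwo_smul (c : ℝ) (x y : Even) :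
    signTwo x (c • y) = c * signTwo x y := by
  simp only [signTwo, plucker, Fin.sum_univ_three, Pi.smul_apply, smul_eq_mul]
  ring

theorem stdOne_add (t : ℝ) (x y z : Even) (i : Fin 3) :
    stdOne t x (y + z) i = stdOne t x y i + stdOne t x z i := by
  simp only [stdOne, plucker, Pi.add_apply]
  ring

theorem stdOne_smul (t : ℝ) (c : ℝ) (x y : Even) (i : Fin 3) :
    stdOne t x (c • y) i = c * stdOne t x y i := by
  simp only [stdOne, plucker, Pi.smul_apply, smul_eq_mul]
  ring

theorem stdTwo_add (x y z : Even) (i : Fin 3) :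
    stdTwo x (y + z) i = stdTwo x y i + stdTwo x z i := by
  simp only [stdTwo, plucker, Pi.add_apply]
  ring

theorem stdTwo_smul (c : ℝ) (x y : Even) (i : Fin 3) :
    stdTwo x (c • y) i = c * stdTwo x y i := by
  simp only [stdTwo, plucker, Pi.smul_apply, smul_eq_mul]
  ring

theorem stdThree_add (x y z : Even) (i : Fin 3) :
    stdThree x (y + z) i = stdThree x y i + stdThree x z i := by
  simp only [stdThree, plucker, Pi.add_apply]
  ring

theorem stdThree_smul (c : ℝ) (x y : Even) (i : Fin 3) :
    stdThree x (c • y) i = c * stdThree x y i := by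
  simp only [stdThree, plucker, Pi.smul_apply, smul_eq_mul]
  ring


theorem signOne_rot (t : ℝ) (x y : Even) : signOne t (rot x) (rot y) = signOne t x y := by
  simp only [signOne, plucker, rot, Fin.sum_univ_three, Fin3.index_arith]
  ring

theorem signTwo_rot (x y : Even) : signTwo (rot x) (rot y) = signTwo x y := by
  simp only [signTwo, plucker, rot, Fin.sum_univ_three, Fin3.index_arith]
  ring

theorem stdOne_rot (t : ℝ) (x y : Even) (i : Fin 3) :
    stdOne t (rot x) (rot y) i = stdOne t x y (i + 1) := by
  fin_cases i <;> rfl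

theorem stdTwo_rot (x y : Even) (i : Fin 3) :
    stdTwo (rot x) (rot y) i = stdTwo x y (i + 1) := by
  fin_cases i <;> rfl

theorem stdThree_rot (x y : Even) (i : Fin 3) :
    stdThree (rot x) (rot y) i = stdThree x y (i + 1) := by
  fin_cases i <;> rfl

/-- The polarization of `signForm`. -/
noncomputable def signPolar (t a b a' b' : ℝ) : ℝ :=
  (3 + 32 * t) / 256 * (a * a') + t * (4 + t) / 64 * (a * b' + a' * b)
    + t * (27 + 38 * t) / 1536 * (b * b')

/-- The polarization of `standardForm`. -/
noncomputable def standardPolar (t a b c a' b' c' : ℝ) : ℝ :=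
  (3 - 8 * t) / 256 * (a * a') + t * (9 - 14 * t) / 1536 * (b * b')
    + 3 * t * (1 - t) / 4 * (c * c') + t * (1 - t) / 64 * (a * b' + a' * b)
    - 5 * t / 32 * (a * c' + a' * c) - t * (3 + 2 * t) / 64 * (b * c' + b' * c)

/-- The polarization in `y` of the difference of the two sides of `nortonE_eq`. -/
noncomputable def nortonDiff (t : ℝ) (x : Even) : LinearMap.BilinForm ℝ Even :=
  LinearMap.mk₂ ℝ (fun y z => formE t (mulE t x x) (mulE t y z)
      - formE t (mulE t x y) (mulE t x z)
      - signPolar t (signOne t x y) (signTwo x y) (signOne t x z) (signTwo x z)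
      - 2 / 3 * ∑ i, standardPolar t (stdOne t x y i) (stdTwo x y i) (stdThree x y i)
        (stdOne t x z i) (stdTwo x z i) (stdThree x z i))
    (fun y y' z => by
      simp only [mulE_add_left, formE_add_left, mulE_add, formE_add, signOne_add, signTwo_add,
        stdOne_add, stdTwo_add, stdThree_add, signPolar, standardPolar,
        Fin.sum_univ_three]
      ring)
    (fun c y z => by
      simp only [mulE_smul_left, formE_smul_left, mulE_smul, formE_smul, signOne_smul, signTwo_smul,
        stdOne_smul, stdTwo_smul, stdThree_smul, signPolar, standardPolar,
        Fin.sum_univ_three, smul_eq_mul]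
      ring)
    (fun y z z' => by
      simp only [mulE_add, formE_add, signOne_add, signTwo_add, stdOne_add, stdTwo_add,
        stdThree_add, signPolar, standardPolar, Fin.sum_univ_three]
      ring)
    (fun c y z => by
      simp only [mulE_smul, formE_smul, signOne_smul, signTwo_smul, stdOne_smul, stdTwo_smul,
        stdThree_smul, signPolar, standardPolar, Fin.sum_univ_three, smul_eq_mul]
      ring)

theorem nortonDiff_apply (t : ℝ) (x y z : Even) : nortonDiff t x y z =
    formE t (mulE t x x) (mulE t y z) - formE t (mulE t x y) (mulE t x z)
      - signPolar t (signOne t x y) (signTwo x y) (signOne t x z) (signTwo x z)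
      - 2 / 3 * ∑ i, standardPolar t (stdOne t x y i) (stdTwo x y i) (stdThree x y i)
        (stdOne t x z i) (stdTwo x z i) (stdThree x z i) := rfl

theorem nortonDiff_rot (t : ℝ) (x y z : Even) :
    nortonDiff t (rot x) (rot y) (rot z) = nortonDiff t x y z := by
  simp only [nortonDiff_apply, mulE_rot, formE_rot, signOne_rot, signTwo_rot, stdOne_rot,
    stdTwo_rot, stdThree_rot]
  congr 2
  exact Equiv.sum_comp (Equiv.addRight (1 : Fin 3)) (fun i => standardPolar t (stdOne t x y i)
    (stdTwo x y i) (stdThree x y i) (stdOne t x z i) (stdTwo x z i) (stdThree x z i))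

/-- The basis vectors of the even subalgebra. -/
noncomputable def basisE (A i : Fin 3) : Even := Pi.single A (Pi.single i 1)

theorem rot_basisE (A i : Fin 3) : rot (basisE A (i + 1)) = basisE A i := by
  ext B j
  by_cases h : B = A
  · subst h
    simp [rot, basisE, Pi.single_apply]
  · simp [rot, basisE, h]

theorem nortonDiff_comm (t : ℝ) (x y z : Even) : nortonDiff t x y z = nortonDiff t x z y := by
  rw [nortonDiff_apply, nortonDiff_apply, mulE_comm t y z, formE_comm t (mulE t x y)]
  simp only [signPolar, standardPolar, Fin.sum_univ_three]
  ring

theorem basisE_eq :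
    basisE 0 0 = ![![1, 0, 0], ![0, 0, 0], ![0, 0, 0]] ∧
    basisE 0 1 = ![![0, 1, 0], ![0, 0, 0], ![0, 0, 0]] ∧
    basisE 1 0 = ![![0, 0, 0], ![1, 0, 0], ![0, 0, 0]] ∧
    basisE 1 1 = ![![0, 0, 0], ![0, 1, 0], ![0, 0, 0]] ∧
    basisE 1 2 = ![![0, 0, 0], ![0, 0, 1], ![0, 0, 0]] ∧
    basisE 2 0 = ![![0, 0, 0], ![0, 0, 0], ![1, 0, 0]] ∧
    basisE 2 1 = ![![0, 0, 0], ![0, 0, 0], ![0, 1, 0]] ∧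
    basisE 2 2 = ![![0, 0, 0], ![0, 0, 0], ![0, 0, 1]] := by
  refine ⟨?_, ?_, ?_, ?_, ?_, ?_, ?_, ?_⟩ <;>
  · ext A i
    fin_cases A <;> fin_cases i <;> simp [basisE]

-- With basis vectors in both polarized slots only the nine coordinates of `x` remain, which keeps
-- the identity within reach of `ring`. The listed pairs represent all pairs of basis vectors up to
-- rotation and symmetry.
set_option maxHeartbeats 4000000 in
theorem nortonDiff_basisE_of_lt (t : ℝ) (x : Even) {A B j : Fin 3}
    (h : A < B ∨ A = B ∧ j < 2) : nortonDiff t x (basisE A 0) (basisE B j) = 0 := by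
  fin_cases A <;> fin_cases B <;> fin_cases j <;> first
    | exact absurd h (by decide)
    | simp only [Fin.zero_eta, Fin.mk_one, Fin.reduceFinMk, basisE_eq, nortonDiff_apply, formE,
        charE, mulE, polar, signPolar, standardPolar, signOne, signTwo, stdOne, stdTwo, stdThree,
        plucker, Fin.sum_univ_three, Fin3.index_arith, Matrix.cons_val, mul_zero, zero_mul,
        add_zero, zero_add, mul_one, sub_zero, zero_sub, neg_zero, neg_mul, mul_neg, sub_self]
      ring

theorem nortonDiff_basisE_succ (t : ℝ) (x : Even) (A i B j : Fin 3) :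
    nortonDiff t x (basisE A (i + 1)) (basisE B (j + 1)) =
      nortonDiff t (rot x) (basisE A i) (basisE B j) := by
  rw [← nortonDiff_rot, rot_basisE, rot_basisE]

theorem nortonDiff_basisE (t : ℝ) (x : Even) (A i B j : Fin 3) :
    nortonDiff t x (basisE A i) (basisE B j) = 0 := by
  -- Here `j` is the offset between the two indices, which rotation preserves.
  have left (A B j : Fin 3) (h : A < B ∨ A = B ∧ j < 2) (i : Fin 3) :
      nortonDiff t x (basisE A i) (basisE B (j + i)) = 0 := by
    obtain rfl | rfl | rfl : i = 0 ∨ i = 0 + 1 ∨ i = 0 + 1 + 1 := by decide +revert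
    · rw [add_zero, nortonDiff_basisE_of_lt t x h]
    · rw [← add_assoc, add_zero, nortonDiff_basisE_succ, nortonDiff_basisE_of_lt t _ h]
    · rw [← add_assoc, ← add_assoc, add_zero, nortonDiff_basisE_succ, nortonDiff_basisE_succ,
        nortonDiff_basisE_of_lt t _ h]
  rcases lt_trichotomy A B with h | h | h
  · simpa only [sub_add_cancel] using left A B (j - i) (.inl h) i
  -- Interchanging the two vectors negates the offset, so offset `2` becomes offset `1`.
  · have : j - i < 2 ∨ i - j < 2 := by decide +revert
    rcases this with h' | h'
    · simpa only [sub_add_cancel] using left A B (j - i) (.inr ⟨h, h'⟩) i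
    · rw [nortonDiff_comm]
      simpa only [sub_add_cancel] using left B A (i - j) (.inr ⟨h.symm, h'⟩) j
  · rw [nortonDiff_comm]
    simpa only [sub_add_cancel] using left B A (i - j) (.inl h) j

theorem nortonDiff_eq_zero (t : ℝ) (x : Even) : nortonDiff t x = 0 := by
  ext A i B j
  exact nortonDiff_basisE t x A i B j

theorem nortonE_eq (t : ℝ) (x y : Even) :
    formE t (mulE t x x) (mulE t y y) - formE t (mulE t x y) (mulE t x y) =
      signForm t (signOne t x y) (signTwo x y) +
        2 / 3 * ∑ i, standardForm t (stdOne t x y i) (stdTwo x y i) (stdThree x y i) := by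
  have h : nortonDiff t x y y = 0 := by rw [nortonDiff_eq_zero]; rfl
  rw [nortonDiff_apply] at h
  simp only [signPolar, standardPolar, Fin.sum_univ_three] at h
  simp only [signForm, standardForm, Fin.sum_univ_three]
  linear_combination h

theorem nortonE_nonneg {t : ℝ} (h0 : 0 ≤ t) (h1 : t ≤ 1 / 6) (x y : Even) :
    0 ≤ formE t (mulE t x x) (mulE t y y) - formE t (mulE t x y) (mulE t x y) := by
  rw [nortonE_eq]
  exact add_nonneg (signForm_nonneg h0 h1 _ _) <| mul_nonneg (by norm_num) <|
    Finset.sum_nonneg fun i _ => standardForm_nonneg h0 h1 _ _ _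

/-! ### The contribution of the odd vectors, and sufficiency of `t ∈ [0, 1/6]`. -/

-- By bilinearity the left side is `charE (z z) - (charE z) ^ 2` at `i`, where `z = b x - a y`. This
-- explains why every argument on the right is a linear form in `z`.
set_option maxHeartbeats 4000000 in
theorem axis_eq (t : ℝ) (x y : Even) (a b : ℝ) (i : Fin 3) :
    b ^ 2 * charE t (mulE t x x) i + a ^ 2 * charE t (mulE t y y) i
        - 2 * a * b * charE t (mulE t x y) i - (a * charE t y i - b * charE t x i) ^ 2 =
      axisOddForm t
        (b * (x 0 (i + 1) - x 0 (i + 2) + 2 * (x 1 (i + 1) - x 1 (i + 2)))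
          - a * (y 0 (i + 1) - y 0 (i + 2) + 2 * (y 1 (i + 1) - y 1 (i + 2))))
        (b * (x 2 (i + 1) - x 2 (i + 2)) - a * (y 2 (i + 1) - y 2 (i + 2))) +
      axisEvenForm t
        (b * (x 0 (i + 1) + x 0 (i + 2) - 2 * (x 1 (i + 1) + x 1 (i + 2)))
          - a * (y 0 (i + 1) + y 0 (i + 2) - 2 * (y 1 (i + 1) + y 1 (i + 2))))
        (b * (x 1 i + x 2 i / 4 + (x 2 (i + 1) + x 2 (i + 2)) / 16)
          - a * (y 1 i + y 2 i / 4 + (y 2 (i + 1) + y 2 (i + 2)) / 16)) := by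
  simp only [charE, mulE, polar, axisOddForm, axisEvenForm, Matrix.cons_val]
  fin_cases i <;> simp only [Fin.zero_eta, Fin.mk_one, Fin.reduceFinMk, Fin3.index_arith] <;> ring

-- The couplings come from `⟨d_i d_i, x⟩ = 2 charE x i` for even `x`, and the last sum from `⟨d_i
-- d_i, d_j d_j⟩ = 1/8` for `i ≠ j`.
set_option maxHeartbeats 4000000 in
theorem norton_eq (t : ℝ) (u v : M t) :
    form t (u * u) (v * v) - form t (u * v) (u * v) =
      formE t (mulE t (evenPart u) (evenPart u)) (mulE t (evenPart v) (evenPart v))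
        - formE t (mulE t (evenPart u) (evenPart v)) (mulE t (evenPart u) (evenPart v))
      + 2 * ∑ i, (dCoord v i ^ 2 * charE t (mulE t (evenPart u) (evenPart u)) i
        + dCoord u i ^ 2 * charE t (mulE t (evenPart v) (evenPart v)) i
        - 2 * dCoord u i * dCoord v i * charE t (mulE t (evenPart u) (evenPart v)) i
        - (dCoord u i * charE t (evenPart v) i - dCoord v i * charE t (evenPart u) i) ^ 2)
      + 1 / 8 * ∑ i, (dCoord u i * dCoord v (i + 1) - dCoord u (i + 1) * dCoord v i) ^ 2 := by
  simp only [form_eq, dCoord_mul]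
  -- The scalars of the factors are made opaque before `charE` is unfolded on products; the identity
  -- does not depend on their values, nor below on the formula for `mulE`.
  generalize charE t (evenPart u) = cu, charE t (evenPart v) = cv
  simp only [formE, charE, evenPart_mul_s, evenPart_mul_v, evenPart_mul_u]
  generalize mulE t (evenPart u) (evenPart u) = X, mulE t (evenPart v) (evenPart v) = Y,
    mulE t (evenPart u) (evenPart v) = W, dCoord u = a, dCoord v = b
  simp only [Fin.sum_univ_three, Fin3.index_arith]
  ring

theorem norton_nonneg {t : ℝ} (h0 : 0 ≤ t) (h1 : t ≤ 1 / 6) (u v : M t) :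
    0 ≤ form t (u * u) (v * v) - form t (u * v) (u * v) := by
  rw [norton_eq]
  refine add_nonneg (add_nonneg (nortonE_nonneg h0 h1 _ _) ?_) (by positivity)
  refine mul_nonneg zero_le_two (Finset.sum_nonneg fun i _ => ?_)
  rw [axis_eq]
  exact add_nonneg (axisOddForm_nonneg h0 h1 _ _) (axisEvenForm_nonneg h0 h1 _ _)

/-! ### Necessity of `t ∈ [0, 1/6]`. -/

/-- The element of the even subalgebra of `M(t)` with given coordinates. -/
noncomputable def ofEven (t : ℝ) (x : Even) : M t
  | .a i true => x 0 i - t / 2 * x 2 i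
  | .a i false => x 0 i + t / 2 * x 2 i
  | .v i => x 1 i
  | .w i => x 2 i

theorem evenPart_ofEven (t : ℝ) (x : Even) : evenPart (ofEven t x) = x := by
  ext A i
  fin_cases A <;> simp [evenPart, sCoord, ofEven]

theorem dCoord_ofEven (t : ℝ) (x : Even) (i : Fin 3) : dCoord (ofEven t x) i = 0 := by
  simp only [dCoord, ofEven]
  ring

theorem dCoord_ax_sub_ax (t : ℝ) (i j : Fin 3) :
    dCoord (ax t i true - ax t i false) j = if i = j then 1 else 0 := by
  simp only [dCoord, ax, M_sub_apply, e_apply]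
  by_cases h : i = j <;> simp [h, eq_comm]

theorem evenPart_ax_sub_ax (t : ℝ) (i : Fin 3) :
    evenPart (ax t i true - ax t i false) = 0 := by
  ext A j
  fin_cases A <;> simp [evenPart, sCoord, ax, M_sub_apply, e_apply]

/-- The Norton form between `a_1 - a_{-1}` and an element of the even subalgebra. -/
theorem norton_axis (t : ℝ) (x : Even) :
    form t (ofEven t x * ofEven t x)
        ((ax t 0 true - ax t 0 false) * (ax t 0 true - ax t 0 false))
      - form t (ofEven t x * (ax t 0 true - ax t 0 false))
        (ofEven t x * (ax t 0 true - ax t 0 false)) =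
      2 * (axisOddForm t (x 0 1 - x 0 2 + 2 * (x 1 1 - x 1 2)) (x 2 1 - x 2 2) +
        axisEvenForm t (x 0 1 + x 0 2 - 2 * (x 1 1 + x 1 2))
          (x 1 0 + x 2 0 / 4 + (x 2 1 + x 2 2) / 16)) := by
  rw [norton_eq, nortonE_eq]
  simp only [axis_eq, dCoord_ofEven, dCoord_ax_sub_ax, evenPart_ofEven, evenPart_ax_sub_ax]
  simp [Fin.sum_univ_three, signForm, standardForm, signOne, signTwo, stdOne, stdTwo, stdThree,
    plucker, axisOddForm, axisEvenForm]

theorem axisForms_nonneg_of_norton {t : ℝ} (h : NortonInequality (form t)) (a b a' b' : ℝ) :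
    0 ≤ axisOddForm t a b + axisEvenForm t a' b' := by
  -- The coordinates are chosen so that the four linear forms in `norton_axis` take the values `a`,
  -- `b`, `a'`, `b'`.
  have := norton_axis t ![![0, (a + a') / 2, (a' - a) / 2], ![b', 0, 0], ![0, b / 2, -b / 2]]
  have hn := this ▸ sub_nonneg.2 (h (ofEven t _) (ax t 0 true - ax t 0 false))
  refine nonneg_of_mul_nonneg_right (hn.trans_eq ?_) (zero_lt_two (α := ℝ))
  simp [axisOddForm, axisEvenForm]
  ring

theorem mem_Icc_of_norton {t : ℝ} (h : NortonInequality (form t)) :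
    t ∈ Set.Icc (0 : ℝ) (1 / 6) := by
  have hev := axisForms_nonneg_of_norton h 0 0 0 1
  -- These arguments annihilate the square `((3 + 12 t) a + 10 t b) ^ 2` in `axisOddForm_nonneg`.
  have hodd := axisForms_nonneg_of_norton h (-(10 * t)) (3 + 12 * t) 0 0
  simp only [axisOddForm, axisEvenForm] at hev hodd
  have h1 : 0 ≤ t * (1 - t) := by linarith
  have h0 : 0 ≤ t := by nlinarith
  -- This bound excludes `t ≥ 9 / 4`, where `(1 - 6 t) (9 - 4 t)` is nonnegative again.
  have ht1 : t ≤ 1 := by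
    by_contra! hc
    nlinarith
  refine ⟨h0, ?_⟩
  by_contra! hc
  -- The value in `hodd` is `-1 / 128` times this product.
  have h2 : 0 < t * (3 + 12 * t) * ((6 * t - 1) * (9 - 4 * t)) := by
    have : 0 < 6 * t - 1 := by linarith
    have : 0 < 9 - 4 * t := by linarith
    have : 0 < t := by linarith
    positivity
  nlinarith

end FourA

theorem proposition6p6 (t : ℝ) :
    FourA.NortonInequality (FourA.form t) ↔ t ∈ Set.Icc (0 : ℝ) (1 / 6) :=
  ⟨FourA.mem_Icc_of_norton, fun h u v => sub_nonneg.1 (FourA.norton_nonneg h.1 h.2 u v)⟩
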